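/- Let $\mathfrak{g}$ be a finite-dimensional simple Lie algebra over $\mathbb{C}$ equipped with a nondegenerate symmetric invariant bilinear form $\langle\cdot,\cdot\rangle$. Let $\mathfrak{h}$ be a Cartan subalgebra, $\Delta$ the root system, $\Delta_+$ a system of positive roots, $\mathfrak{g}_\alpha$ ($\alpha\in\Delta$) the root spaces, $h_\alpha\in[\mathfrak{g}_\alpha,\mathfrak{g}_{-\alpha}]$ the coroot, with $\alpha(h_\alpha)=2$, and $\theta$ the highest root. Let $\lambda\in\mathfrak{h}^*$ be dominant integral, i.e. $\lambda(h_\alpha)\in\mathbb{Z}_{\ge 0}$ for all $\alpha\in\Delta_+$, let $L_\lambda$ be the irreducible highest weight $\mathfrak{g}$-module of highest weight $\lambda$, and let $\partial:N_\lambda\to L_\lambda$ be an isomorphism of $\mathfrak{g}$-modules. Let $A_\lambda=\mathbb{C}\hat 1\oplus N_\lambda$ be the commutative associative algebra with identity $\hat 1$ and $a*a'=0$ for $a,a'\in N_\lambda$; let $\mathfrak{g}$ act on it by $g\cdot(\beta\hat 1+a)=g\cdot a$ for $\beta\in\mathbb{C}$, $a\in N_\lambda$, and extend $\partial$ to $A_\lambda$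 by $\partial(\hat 1)=0$. On $B_\lambda=\mathfrak{g}\oplus\partial(A_\lambda)$ consider, for $g,g'\in\mathfrak{g}$, $m,m'\in\partial(A_\lambda)$, $a,a'\in A_\lambda$, $n\in N_\lambda$, $\beta\in\mathbb{C}$, the bilinear operations - (bracket) $[g+m,g'+m']=[g,g']+g\cdot m'$, - (anchor) $\pi(g+m)(a)=g\cdot a$, - (pairing) $\langle g+\partial(a),g'+\partial(a')\rangle=\langle g,g'\rangle\hat 1+g\cdot a'+g'\cdot a$, - (action of $A_\lambda$) $(\beta\hat 1+n)\cdot(g+m)=\beta(g+m)+\partial(g\cdot n)$. Recall that for a unital commutative associative $\mathbb{C}$-algebra $(A,*)$ a vertex $A$-algebroid is a complex vector space $\Gamma$ with a bilinear map $A\times\Gamma\to\Gamma$, $(a,v)\mapsto a\cdot v$, such that $1\cdot v=v$; a left Leibniz bracket $[\cdot,\cdot]$ (i.e. $[u,[v,w]]=[[u,v],w]+[v,[u,w]]$); a homomorphism of Leibniz algebras $\pi:\Gamma\to\mathrm{Der}(A)$; a symmetric bilinear pairing $\langle\cdot,\cdot\rangle:\Gamma\times\Gamma\to A$; and a linear map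 $\partial:A\to\Gamma$ with $\pi\circ\partial=0$, such that for all $a,a'\in A$ and $u,v,v_1,v_2\in\Gamma$ $$a\cdot(a'\cdot v)-(a*a')\cdot v=\pi(v)(a)\cdot\partial(a')+\pi(v)(a')\cdot\partial(a),\qquad [u,a\cdot v]=\pi(u)(a)\cdot v+a\cdot[u,v],$$ $$[u,v]+[v,u]=\partial(\langle u,v\rangle),\qquad \pi(a\cdot v)=a\,\pi(v),\qquad \langle a\cdot u,v\rangle=a*\langle u,v\rangle-\pi(u)(\pi(v)(a)),$$ $$\pi(v)(\langle v_1,v_2\rangle)=\langle[v,v_1],v_2\rangle+\langle v_1,[v,v_2]\rangle,\qquad \partial(a*a')=a\cdot\partial(a')+a'\cdot\partial(a),$$ $$[v,\partial(a)]=\partial(\pi(v)(a)),\qquad \langle v,\partial(a)\rangle=\pi(v)(a).$$ Assume that $B_\lambda$ with these operations and $\partial$ is a vertex $A_\lambda$-algebroid. Then: 1. $\mathfrak{g}$ is of type $ADE$ (that is, of type $A_n$ with $n\ge1$, $D_n$ with $n\ge4$, $E_6$, $E_7$ or $E_8$) and is not of type $E_8$. 2. $\lambda(h_\alpha)=1$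 for every $\alpha\in\Delta_+$; in particular $\lambda(h_\theta)=1$. 3. For every $\alpha\in\Delta_+$, $e_\alpha\in\mathfrak{g}_\alpha$, $f_\alpha\in\mathfrak{g}_{-\alpha}$ and $a\in N_\lambda$, one has $e_\alpha\cdot(e_\alpha\cdot a)=0$ and $f_\alpha\cdot(f_\alpha\cdot a)=0$. -/

import Mathlib

set_option linter.unusedSectionVars false

noncomputable section

/-! ### Vertex algebroids -/

/-- The underlying data of a vertex `A`-algebroid on a complex vector space `Γ`. -/
structure VertexAlgebroidData (A Γ : Type*) [CommRing A] [Algebra ℂ A]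
    [AddCommGroup Γ] [Module ℂ Γ] where
  /-- the (nonassociative) action `(a, v) ↦ a · v` -/
  act : A →ₗ[ℂ] Γ →ₗ[ℂ] Γ
  /-- the Leibniz bracket `[u, v] = u₀v` -/
  bracket : Γ →ₗ[ℂ] Γ →ₗ[ℂ] Γ
  /-- the anchor `π : Γ → Der(A)`, `π(u)(a) = u₀a` -/
  anchor : Γ →ₗ[ℂ] Derivation ℂ A A
  /-- the pairing `⟨u, v⟩ = u₁v` -/
  pairing : Γ →ₗ[ℂ] Γ →ₗ[ℂ] A
  /-- the map `∂ : A → Γ` -/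
  der : A →ₗ[ℂ] Γ

/-- The axioms of a vertex `A`-algebroid. -/
structure VertexAlgebroidData.IsVertexAlgebroid {A Γ : Type*} [CommRing A] [Algebra ℂ A]
    [AddCommGroup Γ] [Module ℂ Γ] (S : VertexAlgebroidData A Γ) : Prop where
  one_act : ∀ v, S.act 1 v = v
  leibniz : ∀ u v w, S.bracket u (S.bracket v w) =
    S.bracket (S.bracket u v) w + S.bracket v (S.bracket u w)
  anchor_bracket : ∀ u v, S.anchor (S.bracket u v) = ⁅S.anchor u, S.anchor v⁆
  pairing_symm : ∀ u v, S.pairing u v = S.pairing v u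
  anchor_der : ∀ a, S.anchor (S.der a) = 0
  act_act : ∀ a a' v, S.act a (S.act a' v) - S.act (a * a') v =
    S.act (S.anchor v a) (S.der a') + S.act (S.anchor v a') (S.der a)
  bracket_act : ∀ u a v, S.bracket u (S.act a v) =
    S.act (S.anchor u a) v + S.act a (S.bracket u v)
  bracket_add_bracket : ∀ u v, S.bracket u v + S.bracket v u = S.der (S.pairing u v)
  anchor_act : ∀ a v, S.anchor (S.act a v) = a • S.anchor v
  pairing_act : ∀ a u v, S.pairing (S.act a u) v =
    a * S.pairing u v - S.anchor u (S.anchor v a)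
  anchor_pairing : ∀ v v₁ v₂, S.anchor v (S.pairing v₁ v₂) =
    S.pairing (S.bracket v v₁) v₂ + S.pairing v₁ (S.bracket v v₂)
  der_mul : ∀ a a', S.der (a * a') = S.act a (S.der a') + S.act a' (S.der a)
  bracket_der : ∀ v a, S.bracket v (S.der a) = S.der (S.anchor v a)
  pairing_der : ∀ v a, S.pairing v (S.der a) = S.anchor v a

/-! ### The algebra `ℂ1 ⊕ N` with `N * N = 0` -/

/-- The vector space `ℂ1 ⊕ N`; the pair `(β, n)` stands for `β1 + n`. -/
def UnitSum (N : Type*) : Type _ := ℂ × N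

namespace UnitSum

variable {N : Type*} [AddCommGroup N] [Module ℂ N]

instance : AddCommGroup (UnitSum N) := inferInstanceAs (AddCommGroup (ℂ × N))

instance : Module ℂ (UnitSum N) := inferInstanceAs (Module ℂ (ℂ × N))

/-- The element `β1 + n`. -/
def mk (β : ℂ) (n : N) : UnitSum N := (β, n)

@[ext] theorem ext {x y : UnitSum N} (h₁ : x.1 = y.1) (h₂ : x.2 = y.2) : x = y :=
  Prod.ext h₁ h₂

/-- `(β1 + n) * (β'1 + n') = ββ'1 + βn' + β'n`. -/
instance : Mul (UnitSum N) := ⟨fun x y => mk (x.1 * y.1) (x.1 • y.2 + y.1 • x.2)⟩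

instance : One (UnitSum N) := ⟨mk 1 0⟩

@[simp] theorem mk_fst (β : ℂ) (n : N) : (mk β n).1 = β := rfl
@[simp] theorem mk_snd (β : ℂ) (n : N) : (mk β n).2 = n := rfl
@[simp] theorem add_fst (x y : UnitSum N) : (x + y).1 = x.1 + y.1 := rfl
@[simp] theorem add_snd (x y : UnitSum N) : (x + y).2 = x.2 + y.2 := rfl
@[simp] theorem zero_fst : (0 : UnitSum N).1 = 0 := rfl
@[simp] theorem zero_snd : (0 : UnitSum N).2 = 0 := rfl
@[simp] theorem smul_fst (c : ℂ) (x : UnitSum N) : (c • x).1 = c * x.1 := rfl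
@[simp] theorem smul_snd (c : ℂ) (x : UnitSum N) : (c • x).2 = c • x.2 := rfl
@[simp] theorem mul_fst (x y : UnitSum N) : (x * y).1 = x.1 * y.1 := rfl
@[simp] theorem mul_snd (x y : UnitSum N) : (x * y).2 = x.1 • y.2 + y.1 • x.2 := rfl
@[simp] theorem one_fst : (1 : UnitSum N).1 = 1 := rfl
@[simp] theorem one_snd : (1 : UnitSum N).2 = 0 := rfl

instance : CommRing (UnitSum N) where
  __ := (inferInstance : AddCommGroup (UnitSum N))
  mul_assoc x y z := by
    ext
    · simp [mul_assoc]
    · simp only [mul_fst, mul_snd, smul_add, smul_smul]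
      rw [add_assoc, mul_comm z.1 x.1, mul_comm z.1 y.1, mul_comm y.1 z.1]
  mul_comm x y := by
    ext
    · simp [mul_comm]
    · simp [add_comm]
  one_mul x := by ext <;> simp
  mul_one x := by ext <;> simp
  zero_mul x := by ext <;> simp
  mul_zero x := by ext <;> simp
  left_distrib x y z := by
    ext
    · simp [mul_add]
    · simp only [mul_snd, add_fst, add_snd, smul_add, add_smul]; abel
  right_distrib x y z := by
    ext
    · simp [add_mul]
    · simp only [mul_snd, add_fst, add_snd, smul_add, add_smul]; abel

instance : Algebra ℂ (UnitSum N) :=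
  Algebra.ofModule
    (fun c x y => by
      ext
      · simp [mul_assoc]
      · simp only [mul_snd, smul_fst, smul_snd, smul_add, smul_smul, mul_comm c])
    (fun c x y => by
      ext
      · simp [mul_left_comm]
      · simp only [mul_snd, smul_fst, smul_snd, smul_add, smul_smul, mul_comm c])

end UnitSum

/-! ### The structure maps on `B = 𝔤 ⊕ ∂(A)` -/

section Construction

variable {𝔤 N L : Type*} [LieRing 𝔤] [LieAlgebra ℂ 𝔤]
  [AddCommGroup N] [Module ℂ N] [LieRingModule 𝔤 N] [LieModule ℂ 𝔤 N]
  [AddCommGroup L] [Module ℂ L] [LieRingModule 𝔤 L] [LieModule ℂ 𝔤 L]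

/-- The vertex algebroid data on `B = 𝔤 ⊕ L` over `A = ℂ1 ⊕ N` determined by a bilinear form
`Φ` on `𝔤` and a `𝔤`-module isomorphism `d : N → L`, extended to `A` by `d 1 = 0`
(so that `L = ∂(A)`); the pair `(g, m)` stands for `g + m`. -/
def standardData (Φ : LinearMap.BilinForm ℂ 𝔤) (d : N ≃ₗ⁅ℂ, 𝔤⁆ L) :
    VertexAlgebroidData (UnitSum N) (𝔤 × L) where
  act := LinearMap.mk₂ ℂ (fun a v => (a.1 • v.1, a.1 • v.2 + d ⁅v.1, a.2⁆))
    (fun a a' v => by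
      ext
      · simp [add_smul]
      · simp only [UnitSum.add_fst, UnitSum.add_snd, lie_add, map_add, add_smul, Prod.snd_add]
        abel)
    (fun c a v => by ext <;> simp [mul_smul])
    (fun a v v' => by
      ext
      · simp
      · simp only [Prod.fst_add, Prod.snd_add, add_lie, map_add, smul_add]
        abel)
    (fun c a v => by
      ext
      · exact smul_comm _ _ _
      · simp only [Prod.smul_fst, Prod.smul_snd, smul_lie, map_smul, smul_add]
        rw [smul_comm])
  bracket := LinearMap.mk₂ ℂ (fun u v => (⁅u.1, v.1⁆, ⁅u.1, v.2⁆))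
    (fun u u' v => by ext <;> simp)
    (fun c u v => by ext <;> simp)
    (fun u v v' => by ext <;> simp)
    (fun c u v => by ext <;> simp)
  anchor :=
    { toFun := fun u => Derivation.mk'
        { toFun := fun a => UnitSum.mk 0 ⁅u.1, a.2⁆
          map_add' := fun a b => by ext <;> simp
          map_smul' := fun c a => by ext <;> simp }
        (fun a b => by ext <;> simp [add_comm])
      map_add' := fun u v => by
        ext a
        · exact (add_zero (0 : ℂ)).symm
        · exact add_lie u.1 v.1 a.2
      map_smul' := fun c u => by
        ext a
        · exact (mul_zero c).symm
        · exact smul_lie c u.1 a.2 }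
  pairing := LinearMap.mk₂ ℂ
    (fun u v => UnitSum.mk (Φ u.1 v.1) (⁅u.1, d.symm v.2⁆ + ⁅v.1, d.symm u.2⁆))
    (fun u u' v => by
      ext
      · simp
      · simp only [Prod.fst_add, Prod.snd_add, add_lie, map_add, lie_add, UnitSum.add_snd, UnitSum.mk_snd]
        abel)
    (fun c u v => by ext <;> simp)
    (fun u v v' => by
      ext
      · simp
      · simp only [Prod.fst_add, Prod.snd_add, add_lie, map_add, lie_add, UnitSum.add_snd, UnitSum.mk_snd]
        abel)
    (fun c u v => by ext <;> simp)
  der :=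
    { toFun := fun a => (0, d a.2)
      map_add' := fun a b => by ext <;> simp
      map_smul' := fun c a => by ext <;> simp }

end Construction

/-! ### Highest weights and Dynkin types -/

section Roots

open LieAlgebra LieAlgebra.IsKilling

variable {𝔤 : Type*} [LieRing 𝔤] [LieAlgebra ℂ 𝔤] [FiniteDimensional ℂ 𝔤] [IsKilling ℂ 𝔤]
  {H : LieSubalgebra ℂ 𝔤} [H.IsCartanSubalgebra]

/-- `l ∈ 𝔥*` is dominant integral: `l(h_α)` is a nonnegative integer for each positive root. -/
def IsDominantIntegral (b : (rootSystem H).Base) (l : Module.Dual ℂ H) : Prop :=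
  ∀ α : H.root, b.IsPos α → ∃ n : ℕ, l (coroot α.1) = n

/-- `V` is (a copy of) the irreducible highest weight module `L(l)`: it is irreducible and has a
nonzero vector of weight `l` killed by all positive root spaces. -/
def IsIrreducibleHighestWeight (b : (rootSystem H).Base) (l : Module.Dual ℂ H)
    (V : Type*) [AddCommGroup V] [Module ℂ V] [LieRingModule 𝔤 V] [LieModule ℂ 𝔤 V] : Prop :=
  LieModule.IsIrreducible ℂ 𝔤 V ∧
    ∃ v : V, v ≠ 0 ∧ (∀ h : H, ⁅(h : 𝔤), v⁆ = l h • v) ∧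
      ∀ α : H.root, b.IsPos α → ∀ x ∈ rootSpace H α.1, ⁅x, v⁆ = 0

/-- `θ` is the highest root: a positive root such that `θ + α` is not a root for any positive
root `α`. -/
def IsHighestRoot (b : (rootSystem H).Base) (θ : H.root) : Prop :=
  b.IsPos θ ∧ ∀ α : H.root, b.IsPos α →
    (rootSystem H).root θ + (rootSystem H).root α ∉ Set.range (rootSystem H).root

/-- The Cartan matrix of `𝔤` is `C`, up to reordering of the simple roots (it does not depend on
the choice of a Cartan subalgebra and of simple roots). -/
def HasCartanMatrix (𝔤 : Type*) [LieRing 𝔤] [LieAlgebra ℂ 𝔤] [FiniteDimensional ℂ 𝔤]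
    [IsKilling ℂ 𝔤] {n : ℕ} (C : Matrix (Fin n) (Fin n) ℤ) : Prop :=
  ∃ (H : LieSubalgebra ℂ 𝔤) (_ : H.IsCartanSubalgebra) (b : (rootSystem H).Base)
    (e : b.support ≃ Fin n), ∀ i j, b.cartanMatrix i j = C (e i) (e j)

/-- `𝔤` is of type `A_n` (`n ≥ 1`), `D_n` (`n ≥ 4`), `E₆`, `E₇` or `E₈`. Here `CartanMatrix.A n` is
the `n × n` Cartan matrix of type `A_n`. -/
def IsADEType (𝔤 : Type*) [LieRing 𝔤] [LieAlgebra ℂ 𝔤] [FiniteDimensional ℂ 𝔤]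
    [IsKilling ℂ 𝔤] : Prop :=
  (∃ n, 1 ≤ n ∧ HasCartanMatrix 𝔤 (CartanMatrix.A n)) ∨
  (∃ n, 4 ≤ n ∧ HasCartanMatrix 𝔤 (CartanMatrix.D n)) ∨
  HasCartanMatrix 𝔤 CartanMatrix.E₆ ∨
  HasCartanMatrix 𝔤 CartanMatrix.E₇ ∨
  HasCartanMatrix 𝔤 CartanMatrix.E₈

end Roots

end

/-!
The compatibility of the pairing with the action of `A = ℂ1 ⊕ N`, applied to `n ∈ N` and
`g, g' ∈ 𝔤`, says that `𝔤` acts on `N` by the Clifford relation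

  `g (g' n) + g' (g n) = Φ(g, g') n`

(`IsVertexAlgebroid.clifford`). All conclusions follow from this relation.

* Since `Φ ≠ 0`, the action of the simple Lie algebra `𝔤` on `N` is faithful. If `Φ(h, h) = 0`, then
  `h² = 0` on `N`, and the Clifford relation gives `[h, [h, x]] = -2 Φ(h, x) h`, hence
  `(ad h)³ = 0`. For `h` in a Cartan subalgebra this forces every root to vanish at `h`, so `h = 0`.
  Hence `Φ` is anisotropic on every Cartan subalgebra. An anisotropic form over `ℂ` lives in
  dimension at most one, so `𝔤` has rank one: it is of type `A₁`, and not of type `E₈`.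
* A root vector `e` satisfies `Φ(e, e) = 0` by invariance, so `e² = 0` on `N`.
* For an `𝔰𝔩₂`-triple `(h, e, f)` attached to a positive root and a highest weight vector `v` with
  `h v = k v`, one gets `0 = e f f v = (2k - 2) f v`, so `k = 1` unless `f v = 0`. In the latter
  case `k v = e f v = 0`, so `h v = 0`, which makes `h` isotropic and is excluded by anisotropy.
-/

/-! ### The Clifford relation -/

section Clifford

variable {𝔤 N : Type*} [LieRing 𝔤] [LieAlgebra ℂ 𝔤]
  [AddCommGroup N] [Module ℂ N] [LieRingModule 𝔤 N] [LieModule ℂ 𝔤 N]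

/-- `𝔤` acts on `N` by the Clifford relation `g g' + g' g = Φ(g, g')`. -/
def IsCliffordAction (Φ : LinearMap.BilinForm ℂ 𝔤) (N : Type*)
    [AddCommGroup N] [Module ℂ N] [LieRingModule 𝔤 N] : Prop :=
  ∀ (g g' : 𝔤) (n : N), ⁅g, ⁅g', n⁆⁆ + ⁅g', ⁅g, n⁆⁆ = Φ g g' • n

/-- The relation is the `N`-component of `⟨a · u, v⟩ = a * ⟨u, v⟩ - π(u)(π(v)(a))` for `a = n`,
`u = g` and `v = g'`, where `n · g = ∂(g n)`. -/
theorem VertexAlgebroidData.IsVertexAlgebroid.clifford {L : Type*}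
    [AddCommGroup L] [Module ℂ L] [LieRingModule 𝔤 L] [LieModule ℂ 𝔤 L]
    {Φ : LinearMap.BilinForm ℂ 𝔤} {d : N ≃ₗ⁅ℂ, 𝔤⁆ L}
    (hB : (standardData Φ d).IsVertexAlgebroid) : IsCliffordAction Φ N := by
  intro g g' n
  have key := congrArg Prod.snd
    (hB.pairing_act (UnitSum.mk 0 n) ((g, 0) : 𝔤 × L) ((g', 0) : 𝔤 × L))
  change ⁅(0 : ℂ) • g, d.symm 0⁆ + ⁅g', d.symm ((0 : ℂ) • (0 : L) + d ⁅g, n⁆)⁆ =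
    ((0 : ℂ) • (⁅g, d.symm 0⁆ + ⁅g', d.symm 0⁆) + Φ g g' • n) - ⁅g, ⁅g', n⁆⁆ at key
  simp only [zero_smul, zero_lie, zero_add, LieModuleEquiv.symm_apply_apply] at key
  rw [key]
  abel

variable {Φ : LinearMap.BilinForm ℂ 𝔤}

theorem IsCliffordAction.lie_lie_self (hN : IsCliffordAction Φ N) {g : 𝔤} (hg : Φ g g = 0)
    (n : N) : ⁅g, ⁅g, n⁆⁆ = 0 := by
  have h := hN g g n
  rw [hg, zero_smul, ← two_smul ℂ] at h
  exact (smul_eq_zero.mp h).resolve_left two_ne_zero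

theorem IsCliffordAction.faithful [LieAlgebra.IsSimple ℂ 𝔤] [Nontrivial N]
    (hN : IsCliffordAction Φ N) (hΦ : Φ ≠ 0) {x : 𝔤} (hx : ∀ n : N, ⁅x, n⁆ = 0) : x = 0 := by
  rcases LieAlgebra.IsSimple.eq_bot_or_eq_top (LieModule.ker ℂ 𝔤 N) with h | h
  · have : x ∈ LieModule.ker ℂ 𝔤 N := (LieModule.mem_ker ℂ 𝔤 N x).mpr hx
    rwa [h, LieSubmodule.mem_bot] at this
  · have h0 (y : 𝔤) (n : N) : ⁅y, n⁆ = 0 :=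
      (LieModule.mem_ker ℂ 𝔤 N y).mp (h ▸ LieSubmodule.mem_top y) n
    obtain ⟨n, hn⟩ := exists_ne (0 : N)
    refine absurd ?_ hΦ
    ext y z
    have := hN y z n
    simp only [h0, add_zero] at this
    simpa using (smul_eq_zero.mp this.symm).resolve_right hn

/-- `(ad h)² x = -2 Φ(h, x) h` for an isotropic `h`; it holds in `𝔤` because it holds on the
faithful module `N`. -/
theorem IsCliffordAction.lie_lie_of_isotropic [LieAlgebra.IsSimple ℂ 𝔤] [Nontrivial N]
    (hN : IsCliffordAction Φ N) (hΦ : Φ ≠ 0) {h : 𝔤} (hh : Φ h h = 0) (x : 𝔤) :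
    ⁅h, ⁅h, x⁆⁆ = (-2 * Φ h x) • h := by
  refine sub_eq_zero.mp (hN.faithful hΦ fun n => ?_)
  have h1 : ⁅h, ⁅x, ⁅h, n⁆⁆⁆ = Φ h x • ⁅h, n⁆ := by
    rw [← add_zero ⁅h, ⁅x, ⁅h, n⁆⁆⁆, ← lie_zero x, ← hN.lie_lie_self hh ⁅h, n⁆, hN.lie_lie_self hh,
      ← hN h x ⁅h, n⁆, hN.lie_lie_self hh]
  simp only [sub_lie, lie_lie, lie_sub, smul_lie, h1, hN.lie_lie_self hh, lie_zero, mul_smul]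
  module

end Clifford

/-! ### Rank one -/

theorem finrank_le_one_of_anisotropic {K V : Type*} [Field K] [IsAlgClosed K] [NeZero (2 : K)]
    [AddCommGroup V] [Module K V] (B : LinearMap.BilinForm K V)
    (hB : ∀ v, B v v = 0 → v = 0) : Module.finrank K V ≤ 1 := by
  rcases subsingleton_or_nontrivial V with _ | _
  · simp [Module.finrank_zero_of_subsingleton]
  obtain ⟨v, hv⟩ := exists_ne (0 : V)
  refine finrank_le_one v fun w => ?_
  -- Solve `B (w + t v, w + t v) = 0` for `t`.
  obtain ⟨s, hs⟩ := IsAlgClosed.exists_eq_mul_self (discrim (B v v) (B v w + B w v) (B w w))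
  obtain ⟨t, ht⟩ := exists_quadratic_eq_zero (fun h => hv (hB v h)) ⟨s, hs⟩
  have h0 : w + t • v = 0 := hB _ <| by
    simp only [map_add, LinearMap.add_apply, map_smul, LinearMap.smul_apply, smul_eq_mul]
    linear_combination ht
  exact ⟨-t, by rw [neg_smul]; exact (eq_neg_of_add_eq_zero_left h0).symm⟩

section Rank

open LieAlgebra LieAlgebra.IsKilling

variable {𝔤 N : Type*} [LieRing 𝔤] [LieAlgebra ℂ 𝔤] [FiniteDimensional ℂ 𝔤] [IsSimple ℂ 𝔤]
  [AddCommGroup N] [Module ℂ N] [LieRingModule 𝔤 N] [LieModule ℂ 𝔤 N] [Nontrivial N]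
  {Φ : LinearMap.BilinForm ℂ 𝔤}

/-- A root vector `x` gives `α(h)³ x = (ad h)³ x = 0`, so every root vanishes at an isotropic `h`. -/
theorem IsCliffordAction.cartan_anisotropic (hN : IsCliffordAction Φ N) (hΦ : Φ ≠ 0)
    {H : LieSubalgebra ℂ 𝔤} [H.IsCartanSubalgebra] {h : H} (hh : Φ h h = 0) : h = 0 := by
  have hroot (α : LieModule.Weight ℂ H 𝔤) : LieModule.Weight.toLinear ℂ H 𝔤 α h = 0 := by
    obtain ⟨x, hx, hx0⟩ := α.exists_ne_zero
    have h1 : ⁅(h : 𝔤), x⁆ = α h • x := lie_eq_smul_of_mem_rootSpace hx h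
    have h3 : ⁅(h : 𝔤), ⁅(h : 𝔤), ⁅(h : 𝔤), x⁆⁆⁆ = 0 := by
      rw [hN.lie_lie_of_isotropic hΦ hh x, lie_smul, lie_self, smul_zero]
    rw [h1, lie_smul, lie_smul, h1, lie_smul, h1, smul_smul, smul_smul] at h3
    simpa using (smul_eq_zero.mp h3).resolve_right hx0
  refine (Module.forall_dual_apply_eq_zero_iff ℂ h).mp fun f => ?_
  have hf : f ∈ Submodule.span ℂ (Set.range (LieModule.Weight.toLinear ℂ H 𝔤)) := by
    rw [span_weight_eq_top]; trivial
  induction hf using Submodule.span_induction with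
  | mem _ hx => obtain ⟨α, rfl⟩ := hx; exact hroot α
  | zero => rfl
  | add _ _ _ _ hx hy => simp [hx, hy]
  | smul _ _ _ hx => simp [hx]

theorem IsCliffordAction.card_support_eq_one (hN : IsCliffordAction Φ N) (hΦ : Φ ≠ 0)
    {H : LieSubalgebra ℂ 𝔤} [H.IsCartanSubalgebra] (b : (rootSystem H).Base) :
    Fintype.card b.support = 1 := by
  have hH : Module.finrank ℂ H ≤ 1 :=
    finrank_le_one_of_anisotropic (Φ.restrict H.toSubmodule)
      fun h hh => hN.cartan_anisotropic hΦ hh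
  refine le_antisymm ?_ ?_
  · have hb : LinearIndependent ℂ fun i : b.support => (rootSystem H).root i :=
      b.linearIndepOn_root
    exact hb.fintype_card_le_finrank.trans (Subspace.dual_finrank_eq.trans_le hH)
  · have : Nontrivial (Module.Dual ℂ H) := RootPairing.IsIrreducible.nontrivial (rootSystem H)
    have : Nonempty H.root := by
      by_contra! hempty
      have htop := RootPairing.IsRootSystem.span_root_eq_top (P := rootSystem H)
      rw [Set.range_eq_empty, Submodule.span_empty] at htop
      exact bot_ne_top htop
    have := b.support_nonempty.to_subtype
    exact Fintype.card_pos

theorem IsCliffordAction.isADEType (hN : IsCliffordAction Φ N) (hΦ : Φ ≠ 0)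
    {H : LieSubalgebra ℂ 𝔤} [H.IsCartanSubalgebra] (b : (rootSystem H).Base) :
    IsADEType 𝔤 := by
  have hcard := hN.card_support_eq_one hΦ b
  have hsub : Subsingleton b.support := Fintype.card_le_one_iff_subsingleton.mp hcard.le
  refine Or.inl ⟨1, le_rfl, H, inferInstance, b, Fintype.equivFinOfCardEq hcard, fun i j => ?_⟩
  obtain rfl := Subsingleton.elim i j
  simp [CartanMatrix.A]

theorem IsCliffordAction.eq_one_of_hasCartanMatrix (hN : IsCliffordAction Φ N) (hΦ : Φ ≠ 0)
    {n : ℕ} {C : Matrix (Fin n) (Fin n) ℤ} (hC : HasCartanMatrix 𝔤 C) : n = 1 := by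
  obtain ⟨H, _, b, e, -⟩ := hC
  rw [← Fintype.card_fin n, ← Fintype.card_congr e, hN.card_support_eq_one hΦ b]

/-! ### Root vectors and highest weights -/

/-- Eigenvectors of `ad h` with nonzero eigenvalue are isotropic for an invariant form. -/
theorem apply_self_eq_zero_of_lie_eq_smul {L : Type*} [LieRing L] [LieAlgebra ℂ L]
    {Ψ : LinearMap.BilinForm ℂ L} (hΨ : Ψ.lieInvariant L) {h e : L} {c : ℂ}
    (hc : c ≠ 0) (he : ⁅h, e⁆ = c • e) : Ψ e e = 0 := by
  have key := hΨ h e e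
  rw [he, map_smul, map_smul, LinearMap.smul_apply, smul_eq_mul] at key
  have : c * Ψ e e = 0 := by linear_combination key / 2
  exact (mul_eq_zero.mp this).resolve_left hc

/-- `f v` has `h`-weight `k - 2`, and `f² = 0` on `N`, so `0 = e f f v = (2k - 2) f v`; here
`f v ≠ 0` because `h` is not isotropic. -/
theorem IsCliffordAction.weight_eq_one (hN : IsCliffordAction Φ N) (hΦ : Φ ≠ 0)
    (hΦ_inv : Φ.lieInvariant 𝔤) {H : LieSubalgebra ℂ 𝔤} [H.IsCartanSubalgebra] {h : H} {e f : 𝔤}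
    (t : IsSl2Triple (h : 𝔤) e f) {v : N} (hv : v ≠ 0) {k : ℂ} (hhv : ⁅(h : 𝔤), v⁆ = k • v)
    (hev : ⁅e, v⁆ = 0) : k = 1 := by
  have hff : ⁅f, ⁅f, v⁆⁆ = 0 :=
    hN.lie_lie_self (apply_self_eq_zero_of_lie_eq_smul hΦ_inv (c := -2) (by norm_num)
      (by rw [t.lie_h_f_nsmul, two_nsmul, neg_smul, two_smul])) v
  have hefv : ⁅e, ⁅f, v⁆⁆ = k • v := by
    rw [leibniz_lie, t.lie_e_f, hhv, hev, lie_zero, add_zero]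
  have hfv : ⁅f, v⁆ ≠ 0 := by
    intro h0
    rw [h0, lie_zero] at hefv
    have hk : k = 0 := (smul_eq_zero.mp hefv.symm).resolve_right hv
    -- As `h v = 0`, the Clifford relation for `h` at `v` makes `h` isotropic.
    have hhh := hN h h v
    rw [hhv, hk, zero_smul, lie_zero, add_zero] at hhh
    refine t.h_ne_zero ?_
    rw [hN.cartan_anisotropic hΦ ((smul_eq_zero.mp hhh.symm).resolve_right hv)]
    rfl
  have hhfv : ⁅(h : 𝔤), ⁅f, v⁆⁆ = (k - 2) • ⁅f, v⁆ := by
    rw [leibniz_lie, t.lie_h_f_nsmul, hhv, lie_smul, two_nsmul, neg_lie, add_lie]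
    module
  have h2 : ((k - 2) + k) • ⁅f, v⁆ = 0 := by
    have := leibniz_lie e f ⁅f, v⁆
    rw [hff, lie_zero, t.lie_e_f, hhfv, hefv, lie_smul, ← add_smul] at this
    exact this.symm
  linear_combination (smul_eq_zero.mp h2).resolve_right hfv / 2

end Rank

/-! ### Consequences for the vertex algebroid -/

theorem mainTheorem5 {𝔤 N L : Type*}
    [LieRing 𝔤] [LieAlgebra ℂ 𝔤] [FiniteDimensional ℂ 𝔤] [LieAlgebra.IsSimple ℂ 𝔤]
    [AddCommGroup N] [Module ℂ N] [LieRingModule 𝔤 N] [LieModule ℂ 𝔤 N]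
    [AddCommGroup L] [Module ℂ L] [LieRingModule 𝔤 L] [LieModule ℂ 𝔤 L]
    (Φ : LinearMap.BilinForm ℂ 𝔤) (hΦ_nondeg : Φ.Nondegenerate) (hΦ_symm : Φ.IsSymm)
    (hΦ_inv : Φ.lieInvariant 𝔤)
    (H : LieSubalgebra ℂ 𝔤) [H.IsCartanSubalgebra]
    (b : (LieAlgebra.IsKilling.rootSystem H).Base)
    (l : Module.Dual ℂ H) (hl : IsDominantIntegral b l)
    (hL : IsIrreducibleHighestWeight b l L) (d : N ≃ₗ⁅ℂ, 𝔤⁆ L)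
    (hB : (standardData Φ d).IsVertexAlgebroid) :
    IsADEType 𝔤 ∧ ¬ HasCartanMatrix 𝔤 CartanMatrix.E₈ ∧
    (∀ α : H.root, b.IsPos α → l (LieAlgebra.IsKilling.coroot α.1) = 1) ∧
    (∀ θ : H.root, IsHighestRoot b θ → l (LieAlgebra.IsKilling.coroot θ.1) = 1) ∧
    (∀ α : H.root, b.IsPos α →
      (∀ e ∈ LieAlgebra.rootSpace H α.1, ∀ a : N, ⁅e, ⁅e, a⁆⁆ = 0) ∧
      (∀ f ∈ LieAlgebra.rootSpace H (-α.1), ∀ a : N, ⁅f, ⁅f, a⁆⁆ = 0)) := by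
  have hN : IsCliffordAction Φ N := hB.clifford
  obtain ⟨hirr, v, hv, hhv, hev⟩ := hL
  have hv' : d.symm v ≠ 0 := fun h0 => hv <| by
    rw [← d.apply_symm_apply v, h0, map_zero]
  have : Nontrivial N := ⟨d.symm v, 0, hv'⟩
  have : Nontrivial 𝔤 := LieAlgebra.IsSimple.nontrivial ℂ 𝔤
  obtain ⟨x, hx⟩ := exists_ne (0 : 𝔤)
  have hΦ : Φ ≠ 0 := by
    rintro rfl
    exact hx (hΦ_nondeg.1 x fun _ => rfl)
  have hwt (α : H.root) (hα : b.IsPos α) : l (LieAlgebra.IsKilling.coroot α.1) = 1 := by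
    have hα0 := H.isNonZero_coe_root α
    obtain ⟨h, e, f, t, he, hf⟩ := LieAlgebra.IsKilling.exists_isSl2Triple_of_weight_isNonZero hα0
    obtain rfl := t.h_eq_coroot hα0 he hf
    have hd (g : 𝔤) : ⁅g, d.symm v⁆ = d.symm ⁅g, v⁆ :=
      ((d.symm : L →ₗ⁅ℂ, 𝔤⁆ N).map_lie g v).symm
    refine hN.weight_eq_one hΦ hΦ_inv t hv' ?_ ?_
    · rw [hd, hhv, map_smul]
    · rw [hd, hev α hα e he, map_zero]
  refine ⟨hN.isADEType hΦ b, fun h => by simpa using hN.eq_one_of_hasCartanMatrix hΦ h, hwt,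
    fun θ hθ => hwt θ hθ.1, fun α _ => ?_⟩
  have hα2 := LieAlgebra.IsKilling.root_apply_coroot (H.isNonZero_coe_root α)
  -- Root vectors are eigenvectors of `ad h_α` for the eigenvalues `2` and `-2`, hence isotropic.
  constructor
  · intro e he a
    refine hN.lie_lie_self (apply_self_eq_zero_of_lie_eq_smul hΦ_inv
      (h := LieAlgebra.IsKilling.coroot α.1) (c := 2) two_ne_zero ?_) a
    exact (LieAlgebra.IsKilling.lie_eq_smul_of_mem_rootSpace he _).trans (by rw [hα2])
  · intro f hf a
    refine hN.lie_lie_self (apply_self_eq_zero_of_lie_eq_smul hΦ_inv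
      (h := LieAlgebra.IsKilling.coroot α.1) (c := -2) (neg_ne_zero.mpr two_ne_zero) ?_) a
    exact (LieAlgebra.IsKilling.lie_eq_smul_of_mem_rootSpace hf _).trans
      (by rw [Pi.neg_apply, hα2])
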